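/- Let $n\ge 2$ and let $\mathbb{S}^n\subset\mathbb{R}^{n+1}$ be the unit sphere with its canonical metric $\overline g$; write $T_p\mathbb{S}^n=p^\perp$. A smooth Riemannian metric $g$ on $\mathbb{S}^n$ has minimal equators if for every $v\ne 0$ in $\mathbb{R}^{n+1}$ the equator $\Sigma_v=\{x\in\mathbb{S}^n : \langle x,v\rangle=0\}$ is a minimal hypersurface (zero mean curvature) of $(\mathbb{S}^n,g)$. An algebraic curvature tensor on $\mathbb{R}^{n+1}$ is a four-linear map $R$ with $R(x,y,z,w)=-R(y,x,z,w)=-R(x,y,w,z)=R(z,w,x,y)$ and $R(x,y,z,w)+R(x,z,w,y)+R(x,w,y,z)=0$; it has positive sectional curvature if $R(v,w,v,w)>0$ for every orthonormal pair $v,w$. Let $g$ be a Riemannian metric on $\mathbb{S}^n$ with minimal equators and let $R$ be an algebraic curvature tensor on $\mathbb{R}^{n+1}$ with positive sectional curvature. Suppose that $g$ and $R$ correspond to each other, that is, $g=g_R$ or $R=R_g$, where: * $g_R=\frac{1}{D_R}k_R$, with $(k_R)_p(v,w)=R(p,v,p,w)$ for $p\in\mathbb{S}^n$ and $v,w\in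 T_p\mathbb{S}^n$, and $D_R$ is the positive function on $\mathbb{S}^n$ defined by $dV_{k_R}=D_R^{(n-1)/4}\,dV_{\overline g}$; * $R_g$ is the algebraic curvature tensor such that $R_g(p,v,p,v)=\frac{1}{F_g(p)}\,g_p(v,v)$ for all $p\in\mathbb{S}^n$ and $v\in T_p\mathbb{S}^n$, where $F_g$ is the positive function on $\mathbb{S}^n$ defined by $dV_g=F_g^{(n+1)/4}\,dV_{\overline g}$. Let $T\in GL(n+1,\mathbb{R})$, let $$(R\cdot T)(x,y,z,w)=\frac{1}{|\det T|^{4/(n+1)}}\,R(Tx,Ty,Tz,Tw),$$ and let $\phi(T):\mathbb{S}^n\to\mathbb{S}^n$ be the map $\phi(T)(x)=T(x)/|T(x)|$. Then $R\cdot T=R$ if and only if $\phi(T)$ is an isometry of $(\mathbb{S}^n,g)$, that is, a diffeomorphism of $\mathbb{S}^n$ with $\phi(T)^*g=g$. -/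

import Mathlib

open scoped Manifold ContDiff

noncomputable section

namespace MinimalEquators

/-- The Euclidean space `ℝⁿ⁺¹`. -/
abbrev Euc (n : ℕ) : Type := EuclideanSpace ℝ (Fin (n + 1))

/-- The unit sphere `𝕊ⁿ ⊂ ℝⁿ⁺¹`, with the smooth structure given by Mathlib. -/
abbrev Sph (n : ℕ) : Type := Metric.sphere (0 : Euc n) 1

/-- The tangent space `T_p𝕊ⁿ`. -/
abbrev Tan {n : ℕ} (p : Sph n) : Type := TangentSpace (𝓡 n) p

/-- The identification of `T_p𝕊ⁿ` with the hyperplane of vectors of `ℝⁿ⁺¹` orthogonal to `p`: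
the differential at `p` of the inclusion `𝕊ⁿ → ℝⁿ⁺¹`. -/
def incl {n : ℕ} (p : Sph n) : Tan p →L[ℝ] Euc n :=
  mvfderiv (𝓡 n) (fun x : Sph n => (x : Euc n)) p

/-! ### Algebraic curvature tensors -/

/-- Algebraic curvature tensors on `ℝⁿ⁺¹`. -/
@[ext]
structure AlgCurv (n : ℕ) where
  /-- the underlying four-linear map -/
  toMap : Euc n →ₗ[ℝ] Euc n →ₗ[ℝ] Euc n →ₗ[ℝ] Euc n →ₗ[ℝ] ℝ
  antisymm_left : ∀ x y z w, toMap x y z w = -toMap y x z w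
  antisymm_right : ∀ x y z w, toMap x y z w = -toMap x y w z
  pair_symm : ∀ x y z w, toMap x y z w = toMap z w x y
  bianchi : ∀ x y z w, toMap x y z w + toMap x z w y + toMap x w y z = 0

/-- `R` has positive sectional curvature. -/
def AlgCurv.PosSec {n : ℕ} (R : AlgCurv n) : Prop :=
  ∀ v w : Euc n, ‖v‖ = 1 → ‖w‖ = 1 → inner ℝ v w = 0 → 0 < R.toMap v w v w

/-- The right action of `GL(n+1,ℝ)` on algebraic curvature tensors:
`(R · T)(x,y,z,w) = |det T|^{-4/(n+1)} R(Tx,Ty,Tz,Tw)`. -/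
def AlgCurv.act {n : ℕ} (R : AlgCurv n) (T : Euc n ≃ₗ[ℝ] Euc n) : AlgCurv n where
  toMap := LinearMap.mk₂ ℝ
    (fun x y => (1 / |LinearMap.det (T : Euc n →ₗ[ℝ] Euc n)| ^ ((4 : ℝ) / ((n : ℝ) + 1))) •
      (R.toMap (T x) (T y)).compl₁₂ (T : Euc n →ₗ[ℝ] Euc n) (T : Euc n →ₗ[ℝ] Euc n))
    (by intros; ext; simp; ring) (by intros; ext; simp; ring)
    (by intros; ext; simp; ring) (by intros; ext; simp; ring)
  antisymm_left x y z w := by simp [R.antisymm_left (T x) (T y)]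
  antisymm_right x y z w := by simp [R.antisymm_right (T x) (T y) (T z)]
  pair_symm x y z w := by simp [R.pair_symm (T x) (T y) (T z)]
  bianchi x y z w := by
    have h := R.bianchi (T x) (T y) (T z) (T w)
    simp only [LinearMap.mk₂_apply, LinearMap.smul_apply, LinearMap.compl₁₂_apply, smul_eq_mul,
      LinearEquiv.coe_coe]
    rw [← mul_add, ← mul_add, h, mul_zero]

theorem AlgCurv.act_apply {n : ℕ} (R : AlgCurv n) (T : Euc n ≃ₗ[ℝ] Euc n) (x y z w : Euc n) :
    (R.act T).toMap x y z w =
      1 / |LinearMap.det (T : Euc n →ₗ[ℝ] Euc n)| ^ ((4 : ℝ) / ((n : ℝ) + 1)) *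
        R.toMap (T x) (T y) (T z) (T w) := by
  simp [AlgCurv.act]

/-! ### Riemannian metrics on the sphere and their minimal equators -/

/-- Smooth Riemannian metrics on `𝕊ⁿ`. -/
abbrev SphereMetric (n : ℕ) : Type :=
  Bundle.ContMDiffRiemannianMetric (𝓡 n) ∞ (EuclideanSpace ℝ (Fin n))
    (fun p : Sph n => TangentSpace (𝓡 n) p)

/-- The vector field `Y` on `𝕊ⁿ`, as a section of the tangent bundle, is differentiable at `p`. -/
def DiffFieldAt {n : ℕ} (Y : ∀ p : Sph n, TangentSpace (𝓡 n) p) (p : Sph n) : Prop :=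
  MDifferentiableAt (𝓡 n) (𝓡 n).tangent
    (fun q => (⟨q, Y q⟩ : TangentBundle (𝓡 n) (Sph n))) p

/-- `D` is the Levi-Civita connection of `g`: it is torsion-free and compatible with `g`. Here
`D Y p X` is the covariant derivative of the vector field `Y` at `p` in the direction `X`. The
connection is determined by `g` on all differentiable vector fields. -/
def IsLeviCivita {n : ℕ} (g : SphereMetric n)
    (D : CovariantDerivative (𝓡 n) (EuclideanSpace ℝ (Fin n))
      (fun p : Sph n => TangentSpace (𝓡 n) p)) : Prop :=
  D.torsion = 0 ∧
  ∀ (Y Z : ∀ p : Sph n, TangentSpace (𝓡 n) p) (p : Sph n) (X : TangentSpace (𝓡 n) p),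
    DiffFieldAt Y p → DiffFieldAt Z p →
      mvfderiv (𝓡 n) (fun q => g.inner q (Y q) (Z q)) p X =
        g.inner p (D Y p X) (Z p) + g.inner p (Y p) (D Z p X)

/-- The equator `Σ_v = {x ∈ 𝕊ⁿ | ⟨x, v⟩ = 0}`. -/
def equator {n : ℕ} (v : Euc n) : Set (Sph n) := {x | inner ℝ (x : Euc n) v = 0}

/-- The tangent vectors at `p` that are tangent to the equator `Σ_v` through `p`. -/
def IsTangentToEquator {n : ℕ} (v : Euc n) {p : Sph n} (X : Tan p) : Prop :=
  inner ℝ (incl p X) v = 0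

/-- `N` is a vector field, differentiable at the points of `Σ_v`, whose restriction to `Σ_v` is a
`g`-unit normal field. -/
def IsUnitNormal {n : ℕ} (g : SphereMetric n) (v : Euc n)
    (N : ∀ p : Sph n, TangentSpace (𝓡 n) p) : Prop :=
  ∀ p ∈ equator v, DiffFieldAt N p ∧ g.inner p (N p) (N p) = 1 ∧
    ∀ X : Tan p, IsTangentToEquator v X → g.inner p (N p) X = 0

/-- The equator `Σ_v` is a minimal hypersurface of `(𝕊ⁿ, g)`: at each of its points its mean
curvature, the `g`-trace of the second fundamental form `A(X,Y) = g(∇_X N, Y)` on the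
`(n-1)`-dimensional tangent space of `Σ_v`, is zero. -/
def IsMinimalEquator {n : ℕ} (g : SphereMetric n) (v : Euc n) : Prop :=
  ∃ D, IsLeviCivita g D ∧ ∃ N, IsUnitNormal g v N ∧
    ∀ p ∈ equator v, ∀ e : Fin (n - 1) → Tan p,
      (∀ i, IsTangentToEquator v (e i)) →
      (∀ i j, g.inner p (e i) (e j) = if i = j then 1 else 0) →
      ∑ i, g.inner p (D N p (e i)) (e i) = 0

/-- `g` is a metric with respect to which all equators are minimal. -/
def HasMinimalEquators {n : ℕ} (g : SphereMetric n) : Prop :=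
  ∀ v : Euc n, v ≠ 0 → IsMinimalEquator g v

/-! ### The correspondence -/

/-- The canonical metric on `𝕊ⁿ`. -/
def roundForm {n : ℕ} (p : Sph n) (v w : Tan p) : ℝ := inner ℝ (incl p v) (incl p w)

/-- The two-tensor `k_R` on `𝕊ⁿ`, `(k_R)_p(v,w) = R(p,v,p,w)`. -/
def kForm {n : ℕ} (R : AlgCurv n) (p : Sph n) (v w : Tan p) : ℝ :=
  R.toMap (p : Euc n) (incl p v) (p : Euc n) (incl p w)

/-- The volume element of a positive definite symmetric bilinear form `b` on `T_p𝕊ⁿ`: the volume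
of the parallelepiped spanned by `v₁, …, vₙ`. -/
def volElt {n : ℕ} {p : Sph n} (b : Tan p → Tan p → ℝ) (v : Fin n → Tan p) : ℝ :=
  √(Matrix.of fun i j => b (v i) (v j)).det

/-- `dV_b = ψ dV_{ḡ}` on `𝕊ⁿ`, where `ḡ` is the canonical metric. -/
def HasDensity {n : ℕ} (b : ∀ p : Sph n, Tan p → Tan p → ℝ) (ψ : Sph n → ℝ) : Prop :=
  ∀ (p : Sph n) (v : Fin n → Tan p), volElt (b p) v = ψ p * volElt (roundForm p) v

/-- `g = g_R`: `g = (1/D) k_R`, where `D > 0` satisfies `dV_{k_R} = D^{(n-1)/4} dV_{ḡ}`. -/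
def IsMetricOfCurvature {n : ℕ} (R : AlgCurv n) (g : SphereMetric n) : Prop :=
  ∃ D : Sph n → ℝ, (∀ p, 0 < D p) ∧
    HasDensity (kForm R) (fun p => D p ^ (((n : ℝ) - 1) / 4)) ∧
    ∀ (p : Sph n) (v w : Tan p), g.inner p v w = 1 / D p * kForm R p v w

/-- `R = R_g`: `R(p,v,p,v) = (k_g)_p(v,v)` for all `p` and all `v ∈ T_p𝕊ⁿ`, with `k_g = (1/F) g`,
where `F > 0` satisfies `dV_g = F^{(n+1)/4} dV_{ḡ}`. -/
def IsCurvatureOfMetric {n : ℕ} (g : SphereMetric n) (R : AlgCurv n) : Prop :=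
  ∃ F : Sph n → ℝ, (∀ p, 0 < F p) ∧
    HasDensity (fun p v w => g.inner p v w) (fun p => F p ^ (((n : ℝ) + 1) / 4)) ∧
    ∀ (p : Sph n) (v : Tan p),
      R.toMap (p : Euc n) (incl p v) (p : Euc n) (incl p v) = 1 / F p * g.inner p v v

/-! ### Projective transformations and isometries -/

/-- The map `φ(T) : x ∈ 𝕊ⁿ ↦ T x / |T x| ∈ 𝕊ⁿ`. -/
def phi {n : ℕ} (T : Euc n ≃ₗ[ℝ] Euc n) (x : Sph n) : Sph n :=
  ⟨(1 / ‖T x‖) • T x, by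
    have hx : (x : Euc n) ≠ 0 := ne_zero_of_mem_unit_sphere x
    have hT : ‖T (x : Euc n)‖ ≠ 0 := norm_ne_zero_iff.2 (by simpa using hx)
    simp [norm_smul, hT]⟩

/-- `f` is an isometry of the Riemannian manifold `(𝕊ⁿ, g)`: a diffeomorphism with `f^* g = g`. -/
def IsRiemannianIsometry {n : ℕ} (g : SphereMetric n) (f : Sph n → Sph n) : Prop :=
  (∃ Φ : Diffeomorph (𝓡 n) (𝓡 n) (Sph n) (Sph n) ∞, ⇑Φ = f) ∧
  ∀ (p : Sph n) (v w : Tan p),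
    g.inner (f p) (mfderiv (𝓡 n) (𝓡 n) f p v) (mfderiv (𝓡 n) (𝓡 n) f p w) = g.inner p v w

end MinimalEquators

end

noncomputable section

open scoped EuclideanSpace

namespace MinimalEquators

/-! ### Algebraic curvature tensors are determined by their sectional curvatures -/

namespace AlgCurv

variable {n : ℕ}

/-! Both forms of the correspondence yield `k_R = g / F`, where `F ^ ((n+1)/4)` is the density of
`g`. One positive function `λ` (`phiFactor`) governs two pullbacks under `φ(T)`: `k_R` goes to `λ
k_{R·T}` (`kForm_mfderiv_phi`), and the round volume is multiplied by `λ ^ ((n+1)/4)`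
(`volElt_roundForm_mfderiv_phi`). If `R·T = R`, then `φ(T)` is conformal for `g` with factor `μ = (F
∘ φ(T)) λ / F`. Comparing volumes gives `μ ^ (n/2) = μ ^ ((n+1)/4)`, and the exponents differ for `n
≥ 2`, so `μ = 1`. Conversely, an isometry preserves volume, so `F = (F ∘ φ(T)) λ` and `k_{R·T} =
k_R`; sectional values on the sphere then determine the tensor (`ext_of_sphere`). -/

theorem ext_of_sectional {R S : AlgCurv n}
    (h : ∀ x y, R.toMap x y x y = S.toMap x y x y) : R = S := by
  have key : ∀ x y w, R.toMap x y x w = S.toMap x y x w := by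
    intro x y w
    have e := h x (y + w)
    simp only [map_add, LinearMap.add_apply] at e
    have h1 := h x y
    have h2 := h x w
    have h3 := R.pair_symm x w x y
    have h4 := S.pair_symm x w x y
    linarith
  have swap : ∀ x y z w,
      R.toMap x y z w - S.toMap x y z w = -(R.toMap z y x w - S.toMap z y x w) := by
    intro x y z w
    have e := key (x + z) y w
    simp only [map_add, LinearMap.add_apply] at e
    have h1 := key x y w
    have h2 := key z y w
    linarith
  refine AlgCurv.ext (LinearMap.ext fun x => LinearMap.ext fun y => LinearMap.ext fun z =>
    LinearMap.ext fun w => ?_)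
  -- By `swap`, `R - S` is also antisymmetric in slots 1 and 3, hence invariant under cycling `y, z,
  -- w`. The three terms of its Bianchi sum are therefore equal, so each is zero.
  linarith [swap x z w y, swap x w y z, R.bianchi x y z w, S.bianchi x y z w,
    R.antisymm_left w z x y, S.antisymm_left w z x y, R.pair_symm x y z w, S.pair_symm x y z w,
    R.antisymm_left y w x z, S.antisymm_left y w x z, R.pair_symm x z w y, S.pair_symm x z w y]

theorem apply_self_left (R : AlgCurv n) (x z w : Euc n) : R.toMap x x z w = 0 := by
  have := R.antisymm_left x x z w
  linarith

theorem apply_self_right (R : AlgCurv n) (x y z : Euc n) : R.toMap x y z z = 0 := by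
  have := R.antisymm_right x y z z
  linarith

/-- The sectional curvature only depends on the class of the second vector modulo the first, and
is quadratic in both. -/
theorem sectional_smul_add_smul (R : AlgCurv n) (x y z : Euc n) (a b c d e : ℝ) :
    R.toMap (a • x) (b • y + c • x) (a • x) (d • z + e • x) =
      a ^ 2 * (b * d) * R.toMap x y x z := by
  simp only [map_add, map_smul, LinearMap.add_apply, LinearMap.smul_apply, smul_eq_mul,
    R.apply_self_left, R.apply_self_right]
  ring

theorem ext_of_sphere {R S : AlgCurv n}
    (h : ∀ (p : Sph n) (v : Euc n), inner ℝ (p : Euc n) v = 0 →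
      R.toMap p v p v = S.toMap p v p v) : R = S := by
  refine ext_of_sectional fun x y => ?_
  rcases eq_or_ne x 0 with rfl | hx
  · simp
  have hx' : ‖x‖ ≠ 0 := norm_ne_zero_iff.2 hx
  let p : Sph n := ⟨‖x‖⁻¹ • x, by simp [norm_smul, hx']⟩
  have hp : ‖(p : Euc n)‖ = 1 := norm_eq_of_mem_sphere p
  have hxp : x = ‖x‖ • (p : Euc n) := by simp [p, smul_smul, hx']
  have hy : y = (1 : ℝ) • (y - inner ℝ (p : Euc n) y • (p : Euc n)) +
      (inner ℝ (p : Euc n) y) • (p : Euc n) := by simp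
  have := h p (y - inner ℝ (p : Euc n) y • (p : Euc n))
    (by rw [inner_sub_right, inner_smul_right, real_inner_self_eq_norm_sq, hp]; ring)
  rw [hxp, hy, sectional_smul_add_smul, sectional_smul_add_smul, this]

end AlgCurv

/-! ### The differential of the inclusion -/

variable {n : ℕ}

theorem inner_incl (p : Sph n) (v : Tan p) : inner ℝ (p : Euc n) (incl p v) = 0 := by
  have h := range_mvfderiv_subtypeVal (n := n) p
  have : incl p v ∈ (ℝ ∙ (p : Euc n))ᗮ := by
    rw [← h]; exact ⟨v, rfl⟩
  exact Submodule.mem_orthogonal_singleton_iff_inner_right.1 this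

theorem exists_incl_eq (p : Sph n) {u : Euc n} (hu : inner ℝ (p : Euc n) u = 0) :
    ∃ v : Tan p, incl p v = u := by
  have h := range_mvfderiv_subtypeVal (n := n) p
  have : u ∈ (ℝ ∙ (p : Euc n))ᗮ := Submodule.mem_orthogonal_singleton_iff_inner_right.2 hu
  rw [← h] at this
  exact this

theorem exists_orthonormal_incl (p : Sph n) :
    ∃ v : Fin n → Tan p, Orthonormal ℝ (fun i => incl p (v i)) := by
  have hd : Module.finrank ℝ (ℝ ∙ (p : Euc n))ᗮ = n :=
    Submodule.finrank_orthogonal_span_singleton (ne_zero_of_mem_unit_sphere p)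
  let b := (stdOrthonormalBasis ℝ (ℝ ∙ (p : Euc n))ᗮ).reindex (finCongr hd)
  choose v hv using fun i => exists_incl_eq p
    (Submodule.mem_orthogonal_singleton_iff_inner_right.1 (b i).2)
  refine ⟨v, ?_⟩
  simp only [hv]
  exact b.orthonormal.comp_linearIsometry (ℝ ∙ (p : Euc n))ᗮ.subtypeₗᵢ

/-- Evaluating on such a frame turns an identity of volume elements into one of densities. -/
theorem exists_volElt_roundForm_eq_one (p : Sph n) :
    ∃ v : Fin n → Tan p, volElt (roundForm p) v = 1 := by
  obtain ⟨v, hv⟩ := exists_orthonormal_incl p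
  refine ⟨v, ?_⟩
  have : (Matrix.of fun i j => roundForm p (v i) (v j)) = (1 : Matrix (Fin n) (Fin n) ℝ) := by
    ext i j
    simp [roundForm, orthonormal_iff_ite.1 hv i j, Matrix.one_apply]
  simp [volElt, this]

/-! ### The maps `phi T` and their differentials -/

theorem map_ne_zero_of_sphere (T : Euc n ≃ₗ[ℝ] Euc n) (p : Sph n) : T (p : Euc n) ≠ 0 := by
  simpa using ne_zero_of_mem_unit_sphere p

theorem norm_map_pos (T : Euc n ≃ₗ[ℝ] Euc n) (p : Sph n) : 0 < ‖T (p : Euc n)‖ :=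
  norm_pos_iff.2 (map_ne_zero_of_sphere T p)

theorem coe_phi (T : Euc n ≃ₗ[ℝ] Euc n) (p : Sph n) :
    (phi T p : Euc n) = ‖T (p : Euc n)‖⁻¹ • T p := by
  simp [phi]

theorem contMDiff_phi (T : Euc n ≃ₗ[ℝ] Euc n) : ContMDiff (𝓡 n) (𝓡 n) ∞ (phi T) := by
  have hT : ContMDiff (𝓡 n) 𝓘(ℝ, Euc n) ∞ (fun x : Sph n => T (x : Euc n)) :=
    T.toContinuousLinearEquiv.contDiff.contMDiff.comp contMDiff_coe_sphere
  refine ContMDiff.codRestrict_sphere (f := fun x : Sph n => (1 / ‖T (x : Euc n)‖) • T x) ?_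
    (fun x => (phi T x).2)
  intro x
  have h : ContDiffAt ℝ ∞ (fun y : Euc n => (1 / ‖y‖) • y) (T (x : Euc n)) :=
    (contDiffAt_const.div (contDiffAt_norm ℝ (map_ne_zero_of_sphere T x))
      (norm_map_pos T x).ne').smul contDiffAt_id
  have := ContMDiffAt.comp (I' := 𝓘(ℝ, Euc n)) x h.contMDiffAt (hT x)
  exact this

theorem phi_phi_symm (T : Euc n ≃ₗ[ℝ] Euc n) (p : Sph n) : phi T (phi T.symm p) = p := by
  have h := (norm_map_pos T.symm p).ne'
  have hp : ‖(p : Euc n)‖ = 1 := norm_eq_of_mem_sphere p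
  ext1
  simp [coe_phi, norm_smul, smul_smul, h, hp]

/-- `phi T` as a diffeomorphism, with inverse `phi T⁻¹`. -/
def phiDiffeomorph (T : Euc n ≃ₗ[ℝ] Euc n) : Diffeomorph (𝓡 n) (𝓡 n) (Sph n) (Sph n) ∞ where
  toFun := phi T
  invFun := phi T.symm
  left_inv p := by simpa using phi_phi_symm T.symm p
  right_inv := phi_phi_symm T
  contMDiff_toFun := contMDiff_phi T
  contMDiff_invFun := contMDiff_phi T.symm

/-- Product rule for `x ↦ ‖T x‖⁻¹ • T x`. The value of `c` never matters: determinants with first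
column along `T p`, and `R(T p, ·, T p, ·)`, ignore the radial term. -/
theorem exists_incl_mfderiv_phi (T : Euc n ≃ₗ[ℝ] Euc n) (p : Sph n) (v : Tan p) :
    ∃ c : ℝ, incl (phi T p) (mfderiv (𝓡 n) (𝓡 n) (phi T) p v) =
      ‖T (p : Euc n)‖⁻¹ • T (incl p v) + c • T p := by
  have hT := map_ne_zero_of_sphere T p
  have hι : ∀ q : Sph n, MDifferentiableAt (𝓡 n) 𝓘(ℝ, Euc n) (fun x : Sph n => (x : Euc n)) q :=
    fun q => (contMDiff_coe_sphere (m := 1) q).mdifferentiableAt one_ne_zero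
  have hφ : MDifferentiableAt (𝓡 n) (𝓡 n) (phi T) p :=
    (contMDiff_phi T p).mdifferentiableAt (by simp)
  let T' : Euc n →L[ℝ] Euc n := T.toContinuousLinearEquiv
  let a : Euc n → ℝ := fun y => ‖T' y‖⁻¹
  have hTd : HasFDerivAt T' T' (p : Euc n) := T'.hasFDerivAt
  have ha : DifferentiableAt ℝ a (p : Euc n) :=
    (hTd.differentiableAt.norm ℝ hT).inv (norm_ne_zero_iff.2 hT)
  have hh := (ha.hasFDerivAt.smul hTd).hasMFDerivAt.comp p (hι p).hasMFDerivAt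
  have he : (fun x : Sph n => (x : Euc n)) ∘ phi T =
      (a • ⇑T') ∘ (fun x : Sph n => (x : Euc n)) := by
    ext1 x; simp [coe_phi, a, T']
  have hc := (hι (phi T p)).hasMFDerivAt.comp p hφ.hasMFDerivAt
  rw [he] at hc
  exact ⟨fderiv ℝ a (p : Euc n) (incl p v), DFunLike.congr_fun (hasMFDerivAt_unique hc hh) v⟩

/-! ### Volume elements -/

/-- The determinant on `ℝⁿ⁺¹` with respect to the standard basis. -/
def stdDet (n : ℕ) : Euc n [⋀^Fin (n + 1)]→ₗ[ℝ] ℝ :=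
  (EuclideanSpace.basisFun (Fin (n + 1)) ℝ).toBasis.det

theorem stdDet_apply (f : Fin (n + 1) → Euc n) :
    stdDet n f = (Matrix.of fun i j => f j i).det := by
  rw [stdDet, Module.Basis.det_apply]
  congr 1

/-- Prepending a unit vector orthogonal to all `u i` adds a block `1` to the Gram matrix, and the
enlarged Gram matrix is `Aᵀ A` with `A` square. -/
theorem det_gram_eq_stdDet_cons_sq {x : Euc n} (hx : ‖x‖ = 1) {u : Fin n → Euc n}
    (hu : ∀ i, inner ℝ x (u i) = 0) :
    (Matrix.of fun i j => inner ℝ (u i) (u j)).det =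
      stdDet n (Fin.cons x u : Fin (n + 1) → Euc n) ^ 2 := by
  set f : Fin (n + 1) → Euc n := Fin.cons x u
  have hf : (Matrix.of fun i j => inner ℝ (f i) (f j)) =
      (Matrix.of fun i j => f j i).transpose * (Matrix.of fun i j => f j i) := by
    ext i j
    simp [Matrix.mul_apply, PiLp.inner_apply, mul_comm]
  rw [stdDet_apply, sq]
  nth_rw 2 [← Matrix.det_transpose]
  rw [← Matrix.det_mul, ← hf, Matrix.det_succ_row_zero, Fin.sum_univ_succ]
  simp [f, hu, hx, Matrix.submatrix]

theorem stdDet_cons_map (T : Euc n ≃ₗ[ℝ] Euc n) (x : Euc n) (u : Fin n → Euc n) {a : ℝ}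
    (ha : a ≠ 0) (c : Fin n → ℝ) :
    stdDet n (Fin.cons (a • T x) fun i => a • T (u i) + c i • T x) =
      a ^ (n + 1) * LinearMap.det (T : Euc n →ₗ[ℝ] Euc n) * stdDet n (Fin.cons x u) := by
  have h1 : stdDet n (Fin.cons (a • T x) fun i => a • T (u i) + c i • T x) =
      stdDet n (fun i => a • (T : Euc n →ₗ[ℝ] Euc n) ((Fin.cons x u : Fin (n + 1) → Euc n) i)) := by
    rw [stdDet_apply, stdDet_apply]
    nth_rw 1 [← Matrix.det_transpose]
    nth_rw 2 [← Matrix.det_transpose]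
    -- The radial term `c i • T x` is `c i / a` times the first vector `a • T x`; the leading `0`
    -- leaves that vector unchanged.
    refine Matrix.det_eq_of_forall_row_eq_smul_add_const
      (Fin.cons 0 fun i => c i / a) 0 rfl fun i j => ?_
    refine Fin.cases ?_ (fun i => ?_) i
    · simp
    · simp [Matrix.transpose_apply]
      field_simp
  rw [h1, AlternatingMap.map_smul_univ, stdDet]
  have h2 := Module.Basis.det_comp (EuclideanSpace.basisFun (Fin (n + 1)) ℝ).toBasis
    (T : Euc n →ₗ[ℝ] Euc n) (Fin.cons x u)
  simp only [Function.comp_def] at h2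
  rw [h2]
  simp [mul_assoc]

/-- The function `λ` on the sphere with `dV(φ(T)^* ḡ) = λ^((n+1)/4) dV(ḡ)`. -/
def phiFactor (T : Euc n ≃ₗ[ℝ] Euc n) (p : Sph n) : ℝ :=
  |LinearMap.det (T : Euc n →ₗ[ℝ] Euc n)| ^ ((4 : ℝ) / ((n : ℝ) + 1)) * (‖T (p : Euc n)‖⁻¹) ^ 4

theorem abs_det_pos (T : Euc n ≃ₗ[ℝ] Euc n) : 0 < |LinearMap.det (T : Euc n →ₗ[ℝ] Euc n)| :=
  abs_pos.2 (LinearEquiv.isUnit_det' T).ne_zero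

theorem phiFactor_pos (T : Euc n ≃ₗ[ℝ] Euc n) (p : Sph n) : 0 < phiFactor T p :=
  mul_pos (Real.rpow_pos_of_pos (abs_det_pos T) _) (pow_pos (inv_pos.2 (norm_map_pos T p)) _)

theorem phiFactor_rpow (T : Euc n ≃ₗ[ℝ] Euc n) (p : Sph n) :
    phiFactor T p ^ (((n : ℝ) + 1) / 4) =
      (‖T (p : Euc n)‖⁻¹) ^ (n + 1) * |LinearMap.det (T : Euc n →ₗ[ℝ] Euc n)| := by
  have hn : (n : ℝ) + 1 ≠ 0 := by positivity
  have hT := inv_pos.2 (norm_map_pos T p)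
  rw [phiFactor, Real.mul_rpow (Real.rpow_nonneg (abs_nonneg _) _) (pow_nonneg hT.le _),
    ← Real.rpow_mul (abs_nonneg _), ← Real.rpow_natCast, ← Real.rpow_mul hT.le,
    ← Real.rpow_natCast, mul_comm]
  congr 2
  · push_cast
    ring
  · rw [div_mul_div_cancel₀ hn, div_self four_ne_zero, Real.rpow_one]

theorem volElt_roundForm (p : Sph n) (v : Fin n → Tan p) :
    volElt (roundForm p) v =
      |stdDet n (Fin.cons (p : Euc n) fun i => incl p (v i))| := by
  rw [← Real.sqrt_sq_eq_abs, ← det_gram_eq_stdDet_cons_sq (norm_eq_of_mem_sphere p)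
    fun i => inner_incl p (v i)]
  rfl

theorem volElt_roundForm_mfderiv_phi (T : Euc n ≃ₗ[ℝ] Euc n) (p : Sph n) (v : Fin n → Tan p) :
    volElt (roundForm (phi T p)) (fun i => mfderiv (𝓡 n) (𝓡 n) (phi T) p (v i)) =
      phiFactor T p ^ (((n : ℝ) + 1) / 4) * volElt (roundForm p) v := by
  choose c hc using fun i => exists_incl_mfderiv_phi T p (v i)
  have hT := inv_pos.2 (norm_map_pos T p)
  rw [volElt_roundForm, volElt_roundForm, phiFactor_rpow]
  simp only [hc]
  rw [coe_phi, stdDet_cons_map T _ _ hT.ne', abs_mul, abs_mul, abs_of_pos (pow_pos hT _)]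

theorem volElt_const_mul {p : Sph n} (b : Tan p → Tan p → ℝ) {c : ℝ} (hc : 0 ≤ c)
    (v : Fin n → Tan p) :
    volElt (fun x y => c * b x y) v = c ^ ((n : ℝ) / 2) * volElt b v := by
  have : (Matrix.of fun i j => c * b (v i) (v j)) = c • Matrix.of fun i j => b (v i) (v j) := by
    ext i j; simp
  rw [volElt, this, Matrix.det_smul, Real.sqrt_mul (by positivity), volElt, Fintype.card_fin,
    Real.sqrt_eq_rpow, ← Real.rpow_natCast, ← Real.rpow_mul hc, mul_one_div]

/-! ### The correspondence between metrics and curvature tensors -/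

/-- Each of the four slots contributes `‖T p‖⁻¹`, and the power of `|det T|` in `phiFactor` cancels
the normalization of `R.act T`. -/
theorem kForm_mfderiv_phi (R : AlgCurv n) (T : Euc n ≃ₗ[ℝ] Euc n) (p : Sph n) (v w : Tan p) :
    kForm R (phi T p) (mfderiv (𝓡 n) (𝓡 n) (phi T) p v) (mfderiv (𝓡 n) (𝓡 n) (phi T) p w) =
      phiFactor T p * kForm (R.act T) p v w := by
  obtain ⟨c, hc⟩ := exists_incl_mfderiv_phi T p v
  obtain ⟨d, hd⟩ := exists_incl_mfderiv_phi T p w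
  have h := (Real.rpow_pos_of_pos (abs_det_pos T) ((4 : ℝ) / ((n : ℝ) + 1))).ne'
  rw [kForm, hc, hd, coe_phi, AlgCurv.sectional_smul_add_smul, kForm, AlgCurv.act_apply, phiFactor]
  field_simp

theorem IsMetricOfCurvature.isCurvatureOfMetric {R : AlgCurv n} {g : SphereMetric n}
    (h : IsMetricOfCurvature R g) : IsCurvatureOfMetric g R := by
  obtain ⟨D, hD, hV, hg⟩ := h
  -- With `F = 1 / D`, the densities match because `-n/2 + (n-1)/4 = -(n+1)/4`.
  refine ⟨fun p => 1 / D p, fun p => one_div_pos.2 (hD p), fun p v => ?_, fun p v => ?_⟩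
  · simp only [hg]
    rw [volElt_const_mul _ (one_div_pos.2 (hD p)).le, hV, ← mul_assoc, one_div,
      Real.inv_rpow (hD p).le, Real.inv_rpow (hD p).le, ← Real.rpow_neg (hD p).le,
      ← Real.rpow_neg (hD p).le, ← Real.rpow_add (hD p)]
    congr 2
    ring
  · have := (hD p).ne'
    rw [hg, one_div_one_div, ← mul_assoc, mul_one_div_cancel this, one_mul, kForm]

theorem kForm_eq_of_sectional_eq {R : AlgCurv n} {g : SphereMetric n} {F : Sph n → ℝ}
    (h : ∀ (p : Sph n) (v : Tan p),
      R.toMap (p : Euc n) (incl p v) (p : Euc n) (incl p v) = 1 / F p * g.inner p v v)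
    (p : Sph n) (v w : Tan p) : kForm R p v w = 1 / F p * g.inner p v w := by
  have e := h p (v + w)
  have e1 := h p v
  have e2 := h p w
  have e3 := R.pair_symm p (incl p w) p (incl p v)
  simp only [map_add, LinearMap.add_apply, add_apply, g.symm p w v] at e
  rw [kForm]
  linarith

/-- The `g`-volume of the image of a round-unit frame is computed twice: from the conformal factor
`μ`, and from the density of `g` at `phi T p`. -/
theorem rpow_eq_of_pullback_eq_const_mul {g : SphereMetric n} {F : Sph n → ℝ}
    (hF : ∀ p, 0 < F p)
    (hV : HasDensity (fun p v w => g.inner p v w) (fun p => F p ^ (((n : ℝ) + 1) / 4)))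
    (T : Euc n ≃ₗ[ℝ] Euc n) (p : Sph n) {μ : ℝ} (hμ : 0 ≤ μ)
    (h : ∀ v w : Tan p, g.inner (phi T p) (mfderiv (𝓡 n) (𝓡 n) (phi T) p v)
      (mfderiv (𝓡 n) (𝓡 n) (phi T) p w) = μ * g.inner p v w) :
    μ ^ ((n : ℝ) / 2) * F p ^ (((n : ℝ) + 1) / 4) =
      (F (phi T p) * phiFactor T p) ^ (((n : ℝ) + 1) / 4) := by
  obtain ⟨v, hv⟩ := exists_volElt_roundForm_eq_one p
  have h1 := hV (phi T p) fun i => mfderiv (𝓡 n) (𝓡 n) (phi T) p (v i)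
  rw [volElt_roundForm_mfderiv_phi, hv, mul_one,
    ← Real.mul_rpow (hF _).le (phiFactor_pos T p).le] at h1
  have h2 := volElt_const_mul (fun v w : Tan p => g.inner p v w) hμ v
  rw [hV p v, hv, mul_one] at h2
  rw [← h1, ← h2]
  simp only [volElt, h]

theorem act_eq_iff_isRiemannianIsometry (hn : 2 ≤ n) {g : SphereMetric n} {R : AlgCurv n}
    (hgR : IsCurvatureOfMetric g R) (T : Euc n ≃ₗ[ℝ] Euc n) :
    R.act T = R ↔ IsRiemannianIsometry g (phi T) := by
  obtain ⟨F, hF, hV, hk⟩ := hgR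
  replace hk := kForm_eq_of_sectional_eq hk
  have hn' : (2 : ℝ) ≤ n := by exact_mod_cast hn
  constructor
  · refine fun hR => ⟨⟨phiDiffeomorph T, rfl⟩, fun p => ?_⟩
    set μ : ℝ := F (phi T p) * phiFactor T p / F p with hμ_def
    have hμ : 0 < μ := div_pos (mul_pos (hF _) (phiFactor_pos T p)) (hF p)
    have h : ∀ v w : Tan p, g.inner (phi T p) (mfderiv (𝓡 n) (𝓡 n) (phi T) p v)
        (mfderiv (𝓡 n) (𝓡 n) (phi T) p w) = μ * g.inner p v w := by
      intro v w
      have e := kForm_mfderiv_phi R T p v w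
      have h1 := (hF p).ne'
      have h2 := (hF (phi T p)).ne'
      rw [hR, hk, hk] at e
      rw [hμ_def]
      field_simp at e ⊢
      linarith
    have e := rpow_eq_of_pullback_eq_const_mul hF hV T p hμ.le h
    rw [← div_mul_cancel₀ (F (phi T p) * phiFactor T p) (hF p).ne', ← hμ_def,
      Real.mul_rpow hμ.le (hF p).le] at e
    replace e := mul_right_cancel₀ (Real.rpow_pos_of_pos (hF p) _).ne' e
    have hμ1 : μ = 1 := by
      -- For a base other than `1` the exponents `n/2` and `(n+1)/4` would agree, forcing `n = 1`.
      by_contra hne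
      have := (Real.rpow_right_inj hμ hne).1 e
      linarith
    simpa [hμ1] using h
  · rintro ⟨-, h⟩
    refine AlgCurv.ext_of_sphere fun p u hu => ?_
    obtain ⟨v, rfl⟩ := exists_incl_eq p hu
    -- An isometry is the case `μ = 1`.
    have e := rpow_eq_of_pullback_eq_const_mul hF hV T p zero_le_one (by simpa using h p)
    rw [Real.one_rpow, one_mul] at e
    have e' : F p = F (phi T p) * phiFactor T p :=
      (Real.rpow_left_inj (hF p).le (mul_pos (hF _) (phiFactor_pos T p)).le (by positivity)).1 e
    have e1 := kForm_mfderiv_phi R T p v v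
    have e2 := hk p v v
    have h2 := (hF (phi T p)).ne'
    have h3 := (phiFactor_pos T p).ne'
    rw [hk, h] at e1
    change kForm (R.act T) p v v = kForm R p v v
    rw [e2, e']
    field_simp at e1 ⊢
    linarith

end MinimalEquators

end

theorem mainTheorem5 (n : ℕ) (hn : 2 ≤ n)
    (g : MinimalEquators.SphereMetric n) (hg : MinimalEquators.HasMinimalEquators g)
    (R : MinimalEquators.AlgCurv n) (hR : R.PosSec)
    (hgR : MinimalEquators.IsMetricOfCurvature R g ∨ MinimalEquators.IsCurvatureOfMetric g R)
    (T : MinimalEquators.Euc n ≃ₗ[ℝ] MinimalEquators.Euc n) :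
    R.act T = R ↔ MinimalEquators.IsRiemannianIsometry g (MinimalEquators.phi T) :=
  MinimalEquators.act_eq_iff_isRiemannianIsometry hn
    (hgR.elim MinimalEquators.IsMetricOfCurvature.isCurvatureOfMetric id) T
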